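/- Fix a dimension $K$, a constant $C>0$ and a link function $f:\mathbb R\to\mathbb R$. For all $N,J$ let $\theta_i^*\in\mathbb R^K$ ($1\le i\le N$) be true person parameters and $a_j^*\in\mathbb R^K$, $d_j^*\in\mathbb R$ ($1\le j\le J$) true item parameters (all deterministic and allowed to depend on $N,J$), and let $Y_{ij}\in\{0,1\}$, $1\le i\le N$, $1\le j\le J$, be independent random variables with $$P(Y_{ij}=1)=f\big(d_j^*+(a_j^*)^\top\theta_i^*\big).$$ Let $(\hat\theta_i,\hat a_j,\hat d_j)$ be a constrained joint maximum likelihood estimate, i.e. any (not necessarily unique) maximizer of the log-likelihood $$\log\prod_{i=1}^N\prod_{j=1}^J f(d_j+a_j^\top\theta_i)^{Y_{ij}}\big(1-f(d_j+a_j^\top\theta_i)\big)^{1-Y_{ij}}$$ subject to $\sqrt{1+\|\theta_i\|^2}\le C$ and $\sqrt{d_j^2+\|a_j\|^2}\le C$ for all $i,j$, where $\|\cdot\|$ is the Euclidean norm. Assume: (A1) for all $N,J$: $\sqrt{1+\|\theta_i^*\|^2}\le C$ and $\sqrt{(d_j^*)^2+\|a_j^*\|^2}\le C$ for $i=1,\dots,N$,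 $j=1,\dots,J$; (A2) $f$ is differentiable, $0<f(x)<1$ and $f'(x)\ne0$ for $|x|\le C^2$, and $$\sup_{|x|\le C^2}\frac{|f'(x)|}{f(x)(1-f(x))}<\infty,\qquad \sup_{|x|\le C^2}\frac{f(x)(1-f(x))}{(f'(x))^2}<\infty.$$ Then, as $N$ and $J$ both tend to infinity (at arbitrary relative rates), $$\frac1{NJ}\sum_{i=1}^N\sum_{j=1}^J\Big(f(\hat d_j+\hat a_j^\top\hat\theta_i)-f\big(d_j^*+(a_j^*)^\top\theta_i^*\big)\Big)^2\longrightarrow 0\quad\text{in probability.}$$ -/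

import Mathlib

open MeasureTheory ProbabilityTheory Filter Topology

namespace IFA

/-- Parameters of an item factor analysis model with `N` respondents, `J` items and `K` latent
factors: person parameters `θ i`, loadings `a j` and intercepts `d j`. -/
structure Params (N J K : ℕ) where
  θ : Fin N → EuclideanSpace ℝ (Fin K)
  a : Fin J → EuclideanSpace ℝ (Fin K)
  d : Fin J → ℝ

/-- The linear predictor `d_j + a_jᵀ θ_i`. -/
noncomputable def Params.pred {N J K : ℕ} (p : Params N J K) (i : Fin N) (j : Fin J) : ℝ :=
  p.d j + inner ℝ (p.a j) (p.θ i)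

/-- The constraint set `√(1 + ‖θ_i‖²) ≤ C`, `√(d_j² + ‖a_j‖²) ≤ C` for all `i`, `j`. -/
def feasible (N J K : ℕ) (C : ℝ) : Set (Params N J K) :=
  {p | (∀ i, √(1 + ‖p.θ i‖ ^ 2) ≤ C) ∧ ∀ j, √(p.d j ^ 2 + ‖p.a j‖ ^ 2) ≤ C}

/-- The joint likelihood `∏_{i,j} f(d_j + a_jᵀθ_i)^{y_ij} (1 - f(d_j + a_jᵀθ_i))^{1 - y_ij}` of
the dichotomous responses `y_ij ∈ {0, 1}`. -/
noncomputable def likelihood {N J K : ℕ} (f : ℝ → ℝ) (y : Fin N → Fin J → Fin 2)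
    (p : Params N J K) : ℝ :=
  ∏ i, ∏ j, f (p.pred i j) ^ (y i j : ℕ) * (1 - f (p.pred i j)) ^ (1 - (y i j : ℕ))

/-- `p` is a constrained joint maximum likelihood estimate for the data `y`: it is a (not
necessarily unique) maximizer of the joint log-likelihood over the constraint set. -/
def IsCJMLE {N J K : ℕ} (f : ℝ → ℝ) (C : ℝ) (y : Fin N → Fin J → Fin 2)
    (p : Params N J K) : Prop :=
  p ∈ feasible N J K C ∧ IsMaxOn (fun q => Real.log (likelihood f y q)) (feasible N J K C) p

/-- The regularity condition on the link function: `f` is differentiable, and on `|x| ≤ C²` it is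
probability-valued, both ratios `|f'| / (f (1 - f))` and `f (1 - f) / (f')²` are defined
(their denominators do not vanish), and both have a finite supremum. -/
structure RegularLink (f : ℝ → ℝ) (C : ℝ) : Prop where
  differentiable : Differentiable ℝ f
  mem_Ioo : ∀ x, |x| ≤ C ^ 2 → f x ∈ Set.Ioo (0 : ℝ) 1
  deriv_ne_zero : ∀ x, |x| ≤ C ^ 2 → deriv f x ≠ 0
  bdd_left : BddAbove ((fun x => |deriv f x| / (f x * (1 - f x))) '' {x | |x| ≤ C ^ 2})
  bdd_right : BddAbove ((fun x => f x * (1 - f x) / deriv f x ^ 2) '' {x | |x| ≤ C ^ 2})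

/-- The response matrix `Y` follows the item factor model with link `f` and true parameters `p`:
its entries are independent with `P(Y_ij = 1) = f(d_j + a_jᵀ θ_i)`. -/
structure IsModel {N J K : ℕ} {Ω : Type*} [MeasurableSpace Ω] (μ : Measure Ω) (f : ℝ → ℝ)
    (p : Params N J K) (Y : Fin N → Fin J → Ω → Fin 2) : Prop where
  measurable : ∀ i j, Measurable (Y i j)
  prob : ∀ i j, μ.real {ω | Y i j ω = 1} = f (p.pred i j)
  indep : iIndepFun (fun (ij : Fin N × Fin J) => Y ij.1 ij.2) μ

/-- The average squared difference between the response probabilities under `p` and `q`. -/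
noncomputable def avgSqDiff {N J K : ℕ} (f : ℝ → ℝ) (p q : Params N J K) : ℝ :=
  (∑ i, ∑ j, (f (p.pred i j) - f (q.pred i j)) ^ 2) / ((N : ℝ) * (J : ℝ))

end IFA

/-! Comparing the likelihood at the estimate with that at the truth, and bounding the Bernoulli
divergence below by the squared difference of probabilities, bounds the total squared error by a
noise sum weighted by log-odds differences (`IsCJMLE.sum_sq_le`). These weights depend on the data,
so control must be uniform. Persons and items range over fixed compact sets, so rounding each one to
a finite net (`exists_finite_rounding`) leaves at most `m ^ N * n ^ J` weight matrices. Hoeffding's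
inequality gives each a failure probability `exp (-c N J)`. In the union bound `N J` beats `N + J`
once both are large, whatever their ratio. -/

namespace IFA

/-- The log-odds of the response probability at linear predictor `x`. -/
noncomputable def logOdds (f : ℝ → ℝ) (x : ℝ) : ℝ := Real.log (f x) - Real.log (1 - f x)

/-- Person parameters satisfying the norm constraint. -/
def personSet (K : ℕ) (C : ℝ) : Set (EuclideanSpace ℝ (Fin K)) := {θ | √(1 + ‖θ‖ ^ 2) ≤ C}

/-- Item parameters `(d, a)` satisfying the norm constraint. -/
def itemSet (K : ℕ) (C : ℝ) : Set (ℝ × EuclideanSpace ℝ (Fin K)) :=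
  {v | √(v.1 ^ 2 + ‖v.2‖ ^ 2) ≤ C}

lemma isCompact_personSet (K : ℕ) (C : ℝ) : IsCompact (personSet K C) := by
  refine (isCompact_closedBall (0 : EuclideanSpace ℝ (Fin K)) C).of_isClosed_subset
    (isClosed_le (by fun_prop) continuous_const) fun θ hθ => ?_
  rw [mem_closedBall_zero_iff]
  exact (Real.le_sqrt_of_sq_le (by linarith)).trans hθ

lemma isCompact_itemSet (K : ℕ) (C : ℝ) : IsCompact (itemSet K C) := by
  refine (isCompact_closedBall (0 : ℝ × EuclideanSpace ℝ (Fin K)) C).of_isClosed_subset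
    (isClosed_le (by fun_prop) continuous_const) fun v hv => ?_
  rw [mem_closedBall_zero_iff, Prod.norm_def]
  refine max_le ((Real.le_sqrt_of_sq_le ?_).trans hv) ((Real.le_sqrt_of_sq_le ?_).trans hv)
  · rw [Real.norm_eq_abs, sq_abs]
    nlinarith [sq_nonneg ‖v.2‖]
  · nlinarith [sq_nonneg v.1]

/-- Cauchy–Schwarz for `(d, a)` against `(1, θ)`; it keeps predictors in the interval where
`RegularLink` controls `f`. -/
lemma abs_predictor_le {K : ℕ} {C : ℝ} {θ : EuclideanSpace ℝ (Fin K)}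
    {v : ℝ × EuclideanSpace ℝ (Fin K)} (hθ : θ ∈ personSet K C) (hv : v ∈ itemSet K C) :
    |v.1 + inner ℝ v.2 θ| ≤ C ^ 2 := by
  have hin : |inner ℝ v.2 θ| ≤ ‖v.2‖ * ‖θ‖ := abs_real_inner_le_norm _ _
  have h₁ : |v.1 + inner ℝ v.2 θ| ≤ |v.1| + ‖v.2‖ * ‖θ‖ :=
    (abs_add_le _ _).trans (by linarith)
  have h₂ : |v.1| + ‖v.2‖ * ‖θ‖ ≤ √(v.1 ^ 2 + ‖v.2‖ ^ 2) * √(1 + ‖θ‖ ^ 2) := by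
    rw [← Real.sqrt_mul (by positivity)]
    refine Real.le_sqrt_of_sq_le ?_
    nlinarith [sq_nonneg (|v.1| * ‖θ‖ - ‖v.2‖), sq_abs v.1]
  have h₃ : √(v.1 ^ 2 + ‖v.2‖ ^ 2) * √(1 + ‖θ‖ ^ 2) ≤ C * C :=
    mul_le_mul hv hθ (Real.sqrt_nonneg _) ((Real.sqrt_nonneg _).trans hv)
  nlinarith

lemma abs_pred_le {N J K : ℕ} {C : ℝ} {p : Params N J K} (hp : p ∈ feasible N J K C)
    (i : Fin N) (j : Fin J) : |p.pred i j| ≤ C ^ 2 :=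
  abs_predictor_le (v := (p.d j, p.a j)) (hp.1 i) (hp.2 j)

lemma RegularLink.continuousOn_logOdds {f : ℝ → ℝ} {C : ℝ} (hf : RegularLink f C) :
    ContinuousOn (logOdds f) {x | |x| ≤ C ^ 2} := by
  have hc := hf.differentiable.continuous
  refine (hc.continuousOn.log fun x hx => (hf.mem_Ioo x hx).1.ne').sub
    ((continuous_const.sub hc).continuousOn.log fun x hx => ?_)
  exact (sub_pos.2 (hf.mem_Ioo x hx).2).ne'

lemma RegularLink.exists_abs_logOdds_le {f : ℝ → ℝ} {C : ℝ} (hf : RegularLink f C) :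
    ∃ B, 0 < B ∧ ∀ x, |x| ≤ C ^ 2 → |logOdds f x| ≤ B := by
  have hK : IsCompact {x : ℝ | |x| ≤ C ^ 2} := by
    simpa [Metric.closedBall, Real.dist_eq] using isCompact_closedBall (0 : ℝ) (C ^ 2)
  obtain ⟨B, hB⟩ := hK.exists_bound_of_continuousOn hf.continuousOn_logOdds
  -- The maximum with 1 makes the bound strictly positive, as it is divided by later.
  exact ⟨max B 1, by positivity, fun x hx => (hB x hx).trans (le_max_left _ _)⟩

/-! ### The basic inequality -/

/-- The Kullback–Leibler divergence of Bernoulli laws dominates a quarter of the squared difference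
of the success probabilities. -/
lemma sq_sub_le_bernoulli_klDiv {p q : ℝ} (hp : p ∈ Set.Ioo (0 : ℝ) 1)
    (hq : q ∈ Set.Ioo (0 : ℝ) 1) :
    p * (Real.log q - Real.log p) + (1 - p) * (Real.log (1 - q) - Real.log (1 - p))
      ≤ -((q - p) ^ 2 / 4) := by
  -- This is `log t ≤ t - 1` at `t = √y / √x`. Adding the cases `(p, q)` and `(1 - p, 1 - q)` gives
  -- minus the squared Hellinger distance `(√p - √q)² + (√(1-p) - √(1-q))²`.
  have key : ∀ {x y : ℝ}, 0 < x → 0 < y →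
      x * (Real.log y - Real.log x) ≤ 2 * (√x * √y) - 2 * x := by
    intro x y hx hy
    have hsx := Real.sqrt_pos.2 hx
    have hsy := Real.sqrt_pos.2 hy
    have h := Real.log_le_sub_one_of_pos (div_pos hsy hsx)
    rw [Real.log_div hsy.ne' hsx.ne', Real.log_sqrt hx.le, Real.log_sqrt hy.le] at h
    have h' : x * (√y / √x) = √x * √y := by
      nth_rewrite 1 [← Real.mul_self_sqrt hx.le]
      field_simp
    nlinarith
  have h₁ := key hp.1 hq.1
  have h₂ := key (sub_pos.2 hp.2) (sub_pos.2 hq.2)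
  have e₁ := Real.sq_sqrt hp.1.le
  have e₂ := Real.sq_sqrt hq.1.le
  have e₃ := Real.sq_sqrt (sub_pos.2 hp.2).le
  have e₄ := Real.sq_sqrt (sub_pos.2 hq.2).le
  have hs : (√q + √p) ^ 2 ≤ 4 := by
    nlinarith [sq_nonneg (√q - √p), hp.2, hq.2]
  have hd : (q - p) ^ 2 = (√q - √p) ^ 2 * (√q + √p) ^ 2 := by
    rw [← mul_pow, ← e₁, ← e₂, Real.sqrt_sq (Real.sqrt_nonneg _),
      Real.sqrt_sq (Real.sqrt_nonneg _)]
    ring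
  have hm := mul_le_mul_of_nonneg_left hs (sq_nonneg (√q - √p))
  nlinarith [sq_nonneg (√(1 - p) - √(1 - q))]

lemma log_likelihood {N J K : ℕ} {f : ℝ → ℝ} {C : ℝ} (hf : RegularLink f C)
    (y : Fin N → Fin J → Fin 2) {p : Params N J K} (hp : p ∈ feasible N J K C) :
    Real.log (likelihood f y p) = ∑ i, ∑ j, (((y i j : ℕ) : ℝ) * Real.log (f (p.pred i j))
      + (1 - ((y i j : ℕ) : ℝ)) * Real.log (1 - f (p.pred i j))) := by
  have hpos : ∀ i j, 0 < f (p.pred i j) ∧ 0 < 1 - f (p.pred i j) := fun i j =>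
    have h := hf.mem_Ioo _ (abs_pred_le hp i j)
    ⟨h.1, sub_pos.2 h.2⟩
  have hterm : ∀ i j, 0 < f (p.pred i j) ^ (y i j : ℕ) *
      (1 - f (p.pred i j)) ^ (1 - (y i j : ℕ)) := fun i j =>
    mul_pos (pow_pos (hpos i j).1 _) (pow_pos (hpos i j).2 _)
  rw [likelihood, Real.log_prod fun i _ => (Finset.prod_pos fun j _ => hterm i j).ne']
  refine Finset.sum_congr rfl fun i _ => ?_
  rw [Real.log_prod fun j _ => (hterm i j).ne']
  refine Finset.sum_congr rfl fun j _ => ?_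
  rw [Real.log_mul (pow_pos (hpos i j).1 _).ne' (pow_pos (hpos i j).2 _).ne', Real.log_pow,
    Real.log_pow, Nat.cast_sub (by omega), Nat.cast_one]

/-- The basic inequality: the squared error of a constrained maximum likelihood estimate is
controlled by the noise tested against the log-odds differences. -/
lemma IsCJMLE.sum_sq_le {N J K : ℕ} {f : ℝ → ℝ} {C : ℝ} (hf : RegularLink f C)
    {y : Fin N → Fin J → Fin 2} {p q : Params N J K} (hq : IsCJMLE f C y q)
    (hp : p ∈ feasible N J K C) :
    (∑ i, ∑ j, (f (q.pred i j) - f (p.pred i j)) ^ 2) / 4 ≤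
      ∑ i, ∑ j, (((y i j : ℕ) : ℝ) - f (p.pred i j)) *
        (logOdds f (q.pred i j) - logOdds f (p.pred i j)) := by
  have hmax : Real.log (likelihood f y p) ≤ Real.log (likelihood f y q) := hq.2 hp
  rw [log_likelihood hf y hp, log_likelihood hf y hq.1] at hmax
  -- Replacing `y` by its mean `f (p.pred i j)` plus noise splits each entry into noise times
  -- log-odds difference, plus a negative divergence.
  have hsum : ∑ i, ∑ j, ((((y i j : ℕ) : ℝ) * Real.log (f (q.pred i j))
      + (1 - ((y i j : ℕ) : ℝ)) * Real.log (1 - f (q.pred i j))) -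
      (((y i j : ℕ) : ℝ) * Real.log (f (p.pred i j))
      + (1 - ((y i j : ℕ) : ℝ)) * Real.log (1 - f (p.pred i j)))) ≤
      ∑ i, ∑ j, ((((y i j : ℕ) : ℝ) - f (p.pred i j)) *
        (logOdds f (q.pred i j) - logOdds f (p.pred i j)) -
        (f (q.pred i j) - f (p.pred i j)) ^ 2 / 4) := by
    refine Finset.sum_le_sum fun i _ => Finset.sum_le_sum fun j _ => ?_
    have h := sq_sub_le_bernoulli_klDiv (hf.mem_Ioo _ (abs_pred_le hp i j))
      (hf.mem_Ioo _ (abs_pred_le hq.1 i j))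
    simp only [logOdds]
    linarith
  simp only [Finset.sum_sub_distrib, ← Finset.sum_div] at hsum
  linarith

/-! ### Discretisation and concentration -/

/-- Product nets: on a product of compact sets, a continuous function is uniformly approximated
after rounding each factor separately to a finite set. -/
lemma exists_finite_rounding {X Y : Type*} [PseudoMetricSpace X] [PseudoMetricSpace Y]
    {A : Set X} {B : Set Y} (hA : IsCompact A) (hB : IsCompact B) {F : X × Y → ℝ}
    (hF : ContinuousOn F (A ×ˢ B)) {η : ℝ} (hη : 0 < η) :
    ∃ (S : Finset X) (T : Finset Y), (∀ x ∈ S, x ∈ A) ∧ (∀ y ∈ T, y ∈ B) ∧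
      ∃ (r : A → S) (s : B → T), ∀ (x : A) (y : B),
        |F ((x : X), (y : Y)) - F ((r x : X), (s y : Y))| ≤ η := by
  -- The product carries the max metric, so one `δ` serves both factors and they can be rounded
  -- independently.
  obtain ⟨δ, hδ, hu⟩ := Metric.uniformContinuousOn_iff.1
    ((hA.prod hB).uniformContinuousOn_of_continuous hF) η hη
  obtain ⟨S, hSA, hSf, hS⟩ := finite_cover_balls_of_compact hA hδ
  obtain ⟨T, hTB, hTf, hT⟩ := finite_cover_balls_of_compact hB hδ
  have hr : ∀ x : A, ∃ z : hSf.toFinset, dist (x : X) z < δ := fun x => by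
    obtain ⟨z, hz, hxz⟩ := Set.mem_iUnion₂.1 (hS x.2)
    exact ⟨⟨z, hSf.mem_toFinset.2 hz⟩, hxz⟩
  have hs : ∀ y : B, ∃ z : hTf.toFinset, dist (y : Y) z < δ := fun y => by
    obtain ⟨z, hz, hyz⟩ := Set.mem_iUnion₂.1 (hT y.2)
    exact ⟨⟨z, hTf.mem_toFinset.2 hz⟩, hyz⟩
  choose r hr using hr
  choose s hs using hs
  refine ⟨hSf.toFinset, hTf.toFinset, fun x hx => hSA (hSf.mem_toFinset.1 hx),
    fun y hy => hTB (hTf.mem_toFinset.1 hy), r, s, fun x y => ?_⟩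
  rw [← Real.dist_eq]
  exact (hu _ ⟨x.2, y.2⟩ _ ⟨hSA (hSf.mem_toFinset.1 (r x).2), hTB (hTf.mem_toFinset.1 (s y).2)⟩
    (max_lt (hr x) (hs y))).le

lemma natCast_fin_two_eq_indicator {Ω : Type*} (Z : Ω → Fin 2) :
    (fun ω => ((Z ω : ℕ) : ℝ)) = {ω | Z ω = 1}.indicator 1 := by
  ext ω
  by_cases h : Z ω = 1
  · simp [h]
  · have : Z ω = 0 := by omega
    simp [this]

/-- Hoeffding's inequality for weighted sums of the noise. -/
lemma IsModel.measureReal_noise_ge_le {N J K : ℕ} {Ω : Type*} [MeasurableSpace Ω] {μ : Measure Ω}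
    [IsProbabilityMeasure μ] {f : ℝ → ℝ} {p : Params N J K} {Y : Fin N → Fin J → Ω → Fin 2}
    (hY : IsModel μ f p Y) {w : Fin N → Fin J → ℝ} {B : ℝ} (hw : ∀ i j, |w i j| ≤ B)
    {t : ℝ} (ht : 0 ≤ t) :
    μ.real {ω | t ≤ ∑ i, ∑ j, (((Y i j ω : ℕ) : ℝ) - f (p.pred i j)) * w i j} ≤
      Real.exp (-t ^ 2 / (2 * (N * J * B ^ 2))) := by
  -- Each term is centred with values in `[-B, B]`, so Hoeffding's lemma gives variance proxy `(2B /
  -- 2)² = B²`.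
  have hsub : ∀ ij : Fin N × Fin J, HasSubgaussianMGF
      (fun ω => (((Y ij.1 ij.2 ω : ℕ) : ℝ) - f (p.pred ij.1 ij.2)) * w ij.1 ij.2)
      (‖B‖₊ ^ 2) μ := by
    rintro ⟨i, j⟩
    have hm : Measurable (fun ω => ((Y i j ω : ℕ) : ℝ)) :=
      (Measurable.of_discrete (f := fun k : Fin 2 => ((k : ℕ) : ℝ))).comp (hY.measurable i j)
    have hmean : ∫ ω, ((Y i j ω : ℕ) : ℝ) ∂μ = f (p.pred i j) := by
      rw [natCast_fin_two_eq_indicator, ← hY.prob i j]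
      exact integral_indicator_one (hY.measurable i j (measurableSet_singleton 1))
    have hint : Integrable (fun ω => ((Y i j ω : ℕ) : ℝ)) μ := by
      rw [natCast_fin_two_eq_indicator]
      exact (integrable_const (1 : ℝ)).indicator (hY.measurable i j (measurableSet_singleton 1))
    have hp0 : 0 ≤ f (p.pred i j) := hY.prob i j ▸ measureReal_nonneg
    have hp1 : f (p.pred i j) ≤ 1 := hY.prob i j ▸ measureReal_le_one
    have h := hasSubgaussianMGF_of_mem_Icc_of_integral_eq_zero (μ := μ) (a := -B) (b := B)
      (X := fun ω => (((Y i j ω : ℕ) : ℝ) - f (p.pred i j)) * w i j)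
      ((hm.sub_const _).mul_const _).aemeasurable
      (Eventually.of_forall fun ω => ?_) ?_
    · convert h using 2
      rw [sub_neg_eq_add, ← two_mul, nnnorm_mul]
      simp
    · rw [Set.mem_Icc, ← abs_le, abs_mul]
      have hy : ((Y i j ω : ℕ) : ℝ) ≤ 1 := by exact_mod_cast (by omega : (Y i j ω : ℕ) ≤ 1)
      have hy0 : (0 : ℝ) ≤ ((Y i j ω : ℕ) : ℝ) := Nat.cast_nonneg _
      have hz : |((Y i j ω : ℕ) : ℝ) - f (p.pred i j)| ≤ 1 :=
        abs_le.2 ⟨by linarith, by linarith⟩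
      exact (mul_le_of_le_one_left (abs_nonneg _) hz).trans (hw i j)
    · rw [integral_mul_const, integral_sub hint (integrable_const _), hmean]
      simp
  have hind : iIndepFun (fun (ij : Fin N × Fin J) ω =>
      (((Y ij.1 ij.2 ω : ℕ) : ℝ) - f (p.pred ij.1 ij.2)) * w ij.1 ij.2) μ :=
    hY.indep.comp (fun ij k => (((k : ℕ) : ℝ) - f (p.pred ij.1 ij.2)) * w ij.1 ij.2)
      fun _ => Measurable.of_discrete
  have h := HasSubgaussianMGF.measure_sum_ge_le_of_iIndepFun hind (s := Finset.univ)
    (fun ij _ => hsub ij) ht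
  simpa [Fintype.sum_prod_type, mul_assoc] using h

/-! ### Union bound and limit -/

/-- Finite-sample bound: up to an exponential factor in `N + J` coming from the entropy of the
parameter space, the error probability is exponentially small in `N J`. -/
lemma exists_measureReal_avgSqDiff_ge_le (K : ℕ) {C : ℝ} {f : ℝ → ℝ} (hf : RegularLink f C)
    {ε : ℝ} (hε : 0 < ε) :
    ∃ (m n : ℕ) (c : ℝ), 0 < c ∧ ∀ {N J : ℕ} {Ω : Type*} [MeasurableSpace Ω] (μ : Measure Ω)
      [IsProbabilityMeasure μ] (p : Params N J K) (Y : Fin N → Fin J → Ω → Fin 2)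
      (q : Ω → Params N J K), IsModel μ f p Y →
      (∀ᵐ ω ∂μ, IsCJMLE f C (fun i j => Y i j ω) (q ω)) → p ∈ feasible N J K C →
      0 < N → 0 < J →
      μ.real {ω | ε ≤ avgSqDiff f (q ω) p} ≤
        (m : ℝ) ^ N * (n : ℝ) ^ J * Real.exp (-(c * (N * J))) := by
  obtain ⟨B, hB, hbd⟩ := hf.exists_abs_logOdds_le
  let F : EuclideanSpace ℝ (Fin K) × (ℝ × EuclideanSpace ℝ (Fin K)) → ℝ :=
    fun z => logOdds f (z.2.1 + inner ℝ z.2.2 z.1)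
  have hF : ContinuousOn F (personSet K C ×ˢ itemSet K C) :=
    hf.continuousOn_logOdds.comp (Continuous.continuousOn (by fun_prop))
      fun z hz => abs_predictor_le hz.1 hz.2
  -- An average error of at least `ε` forces a noise sum of at least `N J ε / 4`; rounding loses at
  -- most half of it, leaving `N J ε / 8`.
  obtain ⟨S, T, hS, hT, r, s, hrs⟩ := exists_finite_rounding (isCompact_personSet K C)
    (isCompact_itemSet K C) hF (η := ε / 8) (by positivity)
  -- Hoeffding with `t = N J ε / 8` and weights bounded by `2B` has exponent `t² / (8 N J B²)`,
  -- whence 512.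
  refine ⟨S.card, T.card, ε ^ 2 / (512 * B ^ 2), by positivity, ?_⟩
  intro N J Ω _ μ _ p Y q hY hq hp hN hJ
  have hN' : (0 : ℝ) < N := Nat.cast_pos.2 hN
  have hJ' : (0 : ℝ) < J := Nat.cast_pos.2 hJ
  let w : (Fin N → S) × (Fin J → T) → Fin N → Fin J → ℝ := fun g i j =>
    F ((g.1 i : EuclideanSpace ℝ (Fin K)), (g.2 j : ℝ × EuclideanSpace ℝ (Fin K)))
      - logOdds f (p.pred i j)
  let E : (Fin N → S) × (Fin J → T) → Set Ω := fun g =>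
    {ω | N * J * (ε / 8) ≤ ∑ i, ∑ j, (((Y i j ω : ℕ) : ℝ) - f (p.pred i j)) * w g i j}
  have hE : ∀ g, μ.real (E g) ≤ Real.exp (-(ε ^ 2 / (512 * B ^ 2) * (N * J))) := fun g => by
    refine (hY.measureReal_noise_ge_le (B := 2 * B) (w := w g) (fun i j => ?_)
      (by positivity)).trans_eq ?_
    · have h₁ := hbd _ (abs_predictor_le (hS _ (g.1 i).2) (hT _ (g.2 j).2))
      have h₂ := hbd _ (abs_pred_le hp i j)
      exact (abs_sub _ _).trans (by linarith)
    · congr 1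
      field_simp
      norm_num
  -- An almost sure inclusion is enough, and the error event need not be measurable.
  have hsub : ∀ᵐ ω ∂μ, ω ∈ {ω | ε ≤ avgSqDiff f (q ω) p} → ω ∈ ⋃ g, E g := by
    filter_upwards [hq] with ω hω hmem
    let x : Fin N → personSet K C := fun i => ⟨(q ω).θ i, hω.1.1 i⟩
    let v : Fin J → itemSet K C := fun j => ⟨((q ω).d j, (q ω).a j), hω.1.2 j⟩
    refine Set.mem_iUnion.2 ⟨(fun i => r (x i), fun j => s (v j)), ?_⟩
    have hbasic := hω.sum_sq_le hf hp
    have hlow : N * J * ε ≤ ∑ i, ∑ j, (f ((q ω).pred i j) - f (p.pred i j)) ^ 2 := by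
      have h : ε ≤ _ / _ := hmem
      rw [le_div_iff₀ (by positivity)] at h
      linarith
    have hround : ∑ i, ∑ j, (((Y i j ω : ℕ) : ℝ) - f (p.pred i j)) *
        (logOdds f ((q ω).pred i j) - logOdds f (p.pred i j)) ≤
        ∑ i, ∑ j, ((((Y i j ω : ℕ) : ℝ) - f (p.pred i j)) *
          w (fun i => r (x i), fun j => s (v j)) i j + ε / 8) := by
      refine Finset.sum_le_sum fun i _ => Finset.sum_le_sum fun j _ => ?_
      have hd : |logOdds f ((q ω).pred i j) - F (r (x i), s (v j))| ≤ ε / 8 := hrs (x i) (v j)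
      have hf' := hf.mem_Ioo _ (abs_pred_le hp i j)
      have hy : ((Y i j ω : ℕ) : ℝ) ≤ 1 := by exact_mod_cast (by omega : (Y i j ω : ℕ) ≤ 1)
      have hy0 : (0 : ℝ) ≤ ((Y i j ω : ℕ) : ℝ) := Nat.cast_nonneg _
      have hz : |((Y i j ω : ℕ) : ℝ) - f (p.pred i j)| ≤ 1 :=
        abs_le.2 ⟨by linarith [hf'.2], by linarith [hf'.1]⟩
      have hprod := (le_abs_self _).trans ((abs_mul _ _).trans_le
        ((mul_le_of_le_one_left (abs_nonneg _) hz).trans hd))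
      simp only [w]
      linarith
    simp only [Finset.sum_add_distrib, Finset.sum_const, Finset.card_univ, Fintype.card_fin,
      nsmul_eq_mul] at hround
    change N * J * (ε / 8) ≤ _
    linarith
  calc μ.real {ω | ε ≤ avgSqDiff f (q ω) p}
      ≤ μ.real (⋃ g, E g) :=
        ENNReal.toReal_mono (measure_ne_top _ _) (measure_mono_ae hsub)
    _ ≤ ∑ g, μ.real (E g) := measureReal_iUnion_fintype_le _
    _ ≤ ∑ _g : (Fin N → S) × (Fin J → T), Real.exp (-(ε ^ 2 / (512 * B ^ 2) * (N * J))) :=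
        Finset.sum_le_sum fun g _ => hE g
    _ = _ := by simp

/-- The exponent is at most `m N + n J - c N J`. For large `N` and `J`, half of `c N J` absorbs `n
J` and the other half `(m + 1) N`; the extra `N` leaves the bound `exp (-N)`. -/
lemma tendsto_pow_mul_pow_mul_exp (m n : ℕ) {c : ℝ} (hc : 0 < c) :
    Tendsto (fun NJ : ℕ × ℕ => (m : ℝ) ^ NJ.1 * (n : ℝ) ^ NJ.2 *
      Real.exp (-(c * (NJ.1 * NJ.2)))) (atTop ×ˢ atTop) (𝓝 0) := by
  have hpow : ∀ k l : ℕ, (k : ℝ) ^ l ≤ Real.exp (k * l) := fun k l => by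
    rw [mul_comm, Real.exp_nat_mul]
    exact pow_le_pow_left₀ (Nat.cast_nonneg _) (by linarith [Real.add_one_le_exp (k : ℝ)]) _
  have hlim : Tendsto (fun NJ : ℕ × ℕ => Real.exp (-(NJ.1 : ℝ))) (atTop ×ˢ atTop) (𝓝 0) :=
    Real.tendsto_exp_neg_atTop_nhds_zero.comp (tendsto_natCast_atTop_atTop.comp tendsto_fst)
  have h₁ : ∀ᶠ NJ : ℕ × ℕ in atTop ×ˢ atTop, 2 * (n : ℝ) / c ≤ (NJ.1 : ℝ) :=
    (tendsto_natCast_atTop_atTop.comp tendsto_fst).eventually_ge_atTop _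
  have h₂ : ∀ᶠ NJ : ℕ × ℕ in atTop ×ˢ atTop, 2 * ((m : ℝ) + 1) / c ≤ (NJ.2 : ℝ) :=
    (tendsto_natCast_atTop_atTop.comp tendsto_snd).eventually_ge_atTop _
  refine squeeze_zero' (Eventually.of_forall fun _ => by positivity) ?_ hlim
  filter_upwards [h₁, h₂] with NJ h₁ h₂
  rw [div_le_iff₀ hc] at h₁ h₂
  calc _ ≤ Real.exp (m * NJ.1) * Real.exp (n * NJ.2) * Real.exp (-(c * (NJ.1 * NJ.2))) := by
        gcongr <;> exact hpow _ _
    _ ≤ _ := by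
        rw [← Real.exp_add, ← Real.exp_add, Real.exp_le_exp]
        have e₁ := mul_le_mul_of_nonneg_right h₁ (Nat.cast_nonneg (α := ℝ) NJ.2)
        have e₂ := mul_le_mul_of_nonneg_right h₂ (Nat.cast_nonneg (α := ℝ) NJ.1)
        linarith

end IFA

/-- Recovery of response probabilities by the constrained joint maximum likelihood estimator.
For each `N` and `J` the data may live on their own probability space and the true parameters may
depend on `N` and `J`; `N` and `J` grow to infinity jointly, at arbitrary relative rates. -/
theorem corollary1 (K : ℕ) (C : ℝ) (hC : 0 < C) (f : ℝ → ℝ)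
    {Ω : ℕ → ℕ → Type*} [∀ N J, MeasurableSpace (Ω N J)]
    (μ : ∀ N J, Measure (Ω N J)) [∀ N J, IsProbabilityMeasure (μ N J)]
    (truth : ∀ N J, IFA.Params N J K)
    (Y : ∀ N J, Fin N → Fin J → Ω N J → Fin 2)
    (est : ∀ N J, Ω N J → IFA.Params N J K)
    (hmodel : ∀ N J, IFA.IsModel (μ N J) f (truth N J) (Y N J))
    (hest : ∀ N J, ∀ᵐ ω ∂(μ N J), IFA.IsCJMLE f C (fun i j => Y N J i j ω) (est N J ω))
    (A1 : ∀ N J, truth N J ∈ IFA.feasible N J K C)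
    (A2 : IFA.RegularLink f C) :
    ∀ ε : ℝ, 0 < ε →
      Tendsto
        (fun NJ : ℕ × ℕ =>
          μ NJ.1 NJ.2 {ω | ε ≤ IFA.avgSqDiff f (est NJ.1 NJ.2 ω) (truth NJ.1 NJ.2)})
        (atTop ×ˢ atTop) (𝓝 0) := by
  intro ε hε
  obtain ⟨m, n, c, hc, hbound⟩ := IFA.exists_measureReal_avgSqDiff_ge_le K A2 hε
  rw [← ENNReal.tendsto_toReal_iff (fun _ => measure_ne_top _ _) ENNReal.zero_ne_top]
  refine squeeze_zero' (Eventually.of_forall fun _ => ENNReal.toReal_nonneg) ?_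
    (IFA.tendsto_pow_mul_pow_mul_exp m n hc)
  filter_upwards [tendsto_fst.eventually (eventually_gt_atTop 0),
    tendsto_snd.eventually (eventually_gt_atTop 0)] with NJ hN hJ
  exact hbound (μ NJ.1 NJ.2) (truth NJ.1 NJ.2) (Y NJ.1 NJ.2) (est NJ.1 NJ.2) (hmodel _ _)
    (hest _ _) (A1 _ _) hN hJ
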